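/- A Boolean circuit with $n$ inputs is a finite directed acyclic graph whose source vertices are inputs $x_1,\dots,x_n$ or constants $0,1$ and whose other vertices are logic gates, each carrying an arbitrary Boolean function of its (at least one) incoming edges; exactly one gate has no outgoing edge, and its value is the output. It has fan-in $k$ if every gate has at most $k$ incoming edges. In the $\delta$-noisy version each gate, independently of the others, outputs with probability exactly $\delta$ the negation of the correct value for the inputs it receives; $C_\delta(x)$ denotes the resulting random output on input $x$. For $k\in\mathbb N$ and $\delta\in[0,\tfrac12]$, we say that reliable computation is possible at $(k,\delta)$ if there is $\varepsilon>0$ such that for every $n$ and every $f:\{0,1\}^n\to\{0,1\}$ there is a circuit $C$ of fan-in $k$ with $n$ inputs satisfying $\mathbb P(C_\delta(x)\neq f(x))\le \tfrac12-\varepsilon$ for all $x\in\{0,1\}^n$. Let $$\delta^*(k)=\sup\{\delta\in[0,\tfrac12] : \text{reliable computation is possible at }(k,\delta)\},\qquad \delta^*_{\mathrm{ES}}(k)=\frac12-\frac1{2\sqrt k}.$$ **Lemma.** As $k\to\infty$, $\delta^*(k)\to\frac12$, and $\delta^*(k)$ converges to $\frac12$ at the same rate as $\delta^*_{\mathrm{ES}}(k)$: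 $$\tfrac12-\delta^*(k)=\Theta\bigl(\tfrac12-\delta^*_{\mathrm{ES}}(k)\bigr)=\Theta\bigl(1/\sqrt k\bigr).$$ Moreover, the lower bound holds in the strict sense of a threshold: there is a constant $c>0$ such that for all sufficiently large $k$, reliable computation is possible at $(k,\delta)$ for every $0\le\delta\le \frac12-\frac{c}{\sqrt k}$. -/

import Mathlib

open Filter Topology Asymptotics

/-- The possible origins of a wire in a circuit with `n` inputs whose logic gates are the
elements of `G`: one of the two constants, one of the inputs, or the output of a gate. -/
inductive WireSource (n : ℕ) (G : Type) where
  | const (b : Bool) : WireSource n G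
  | input (i : Fin n) : WireSource n G
  | gate (g : G) : WireSource n G

/-- A Boolean circuit with `n` inputs and a single output. The logic gates are the vertices with
at least one incoming edge; each carries an arbitrary Boolean function of its incoming wires. -/
structure BooleanCircuit (n : ℕ) where
  /-- the logic gates -/
  Gate : Type
  [fintypeGate : Fintype Gate]
  [decEqGate : DecidableEq Gate]
  /-- the number of inputs of a gate -/
  fanIn : Gate → ℕ
  fanIn_pos : ∀ g, 0 < fanIn g
  /-- the Boolean function attached to a gate -/
  op : (g : Gate) → (Fin (fanIn g) → Bool) → Bool
  /-- where the inputs of a gate come from -/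
  wire : (g : Gate) → Fin (fanIn g) → WireSource n Gate
  /-- The directed graph is acyclic: as there are finitely many gates, having no directed cycle
  is the same as well-foundedness of the relation "`h` feeds `g`". -/
  acyclic : WellFounded fun h g : Gate => ∃ a, wire g a = WireSource.gate h
  /-- the output gate -/
  out : Gate
  /-- The output gate is the one and only gate without outgoing edges. -/
  sink_iff : ∀ g, (∀ h a, wire h a ≠ WireSource.gate g) ↔ g = out

namespace BooleanCircuit

attribute [instance] BooleanCircuit.fintypeGate BooleanCircuit.decEqGate

variable {n : ℕ}

/-- The circuit only has gates with at most `k` inputs. -/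
def FanInLE (C : BooleanCircuit n) (k : ℕ) : Prop :=
  ∀ g, C.fanIn g ≤ k

/-- The bit that gate `g` sends out on input `x` when exactly the gates `h` with
`e h = true` malfunction, that is, negate the correct value for the inputs they receive. -/
def value (C : BooleanCircuit n) (x : Fin n → Bool) (e : C.Gate → Bool) : C.Gate → Bool :=
  C.acyclic.fix fun g ih =>
    xor (e g) (C.op g fun a =>
      match hs : C.wire g a with
      | WireSource.const b => b
      | WireSource.input i => x i
      | WireSource.gate h => ih h ⟨a, hs⟩)

/-- The recursion that `value` satisfies. -/
theorem value_eq (C : BooleanCircuit n) (x : Fin n → Bool) (e : C.Gate → Bool) (g : C.Gate) :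
    C.value x e g = xor (e g) (C.op g fun a =>
      match C.wire g a with
      | WireSource.const b => b
      | WireSource.input i => x i
      | WireSource.gate h => C.value x e h) := by
  unfold value
  rw [WellFounded.fix_eq]
  congr 2
  funext a
  split <;> rename_i hs <;> simp [hs]

/-- The probability of the malfunction pattern `e` when every gate malfunctions with
probability `δ`, independently of the other gates. -/
noncomputable def patternProb (C : BooleanCircuit n) (δ : ℝ) (e : C.Gate → Bool) : ℝ :=
  ∏ g, if e g = true then δ else 1 - δ

/-- The probability that the `δ`-noisy circuit `C` does not output `b` on input `x`. -/
noncomputable def errorProb (C : BooleanCircuit n) (δ : ℝ) (x : Fin n → Bool) (b : Bool) : ℝ :=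
  ∑ e : C.Gate → Bool, if C.value x e C.out ≠ b then C.patternProb δ e else 0

end BooleanCircuit

/-- All Boolean functions can be reliably computed by `δ`-noisy circuits of fan-in `k`. The
margin `ε` may depend on `δ` and `k`, but not on the function. -/
def ReliableComputation (k : ℕ) (δ : ℝ) : Prop :=
  ∃ ε : ℝ, 0 < ε ∧ ∀ (n : ℕ) (f : (Fin n → Bool) → Bool),
    ∃ C : BooleanCircuit n, C.FanInLE k ∧ ∀ x, C.errorProb δ x (f x) ≤ 1 / 2 - ε

/-- The noise threshold `δ*(k)` for circuits of fan-in `k`, where noise levels are in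
`[0, 1/2]`. -/
noncomputable def deltaStar (k : ℕ) : ℝ :=
  sSup {δ : ℝ | 0 ≤ δ ∧ δ ≤ 1 / 2 ∧ ReliableComputation k δ}

/-- The Evans–Schulman bound `δ*_ES(k) = 1/2 - 1/(2√k)`. -/
noncomputable def deltaES (k : ℕ) : ℝ :=
  1 / 2 - 1 / (2 * Real.sqrt k)

/-!
The threshold is bounded from above by the strong data processing inequality and from below by
trees of majority gates.

*Upper bound.* `not_reliableComputation` excludes reliable computation when `(1 - 2δ)² k ≤ 1`. Let
`x` and `y` differ only in the input `i`. The triangular discrimination `∑ (p - q)² / (p + q)` of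
the joint laws of some gate outputs on `x` and on `y` behaves as if each gate were erased with
probability `1 - (1 - 2δ)²` and noiseless otherwise
(`BooleanCircuit.discrimination_noise_le`). Eliminating the gates one after the other, the last ones
first, bounds the discrimination of the output by twice the sum of `(1 - 2δ) ^ (2ℓ)` over all paths
from the input `i` to the output, where `ℓ` counts the gates on the path
(`BooleanCircuit.gateDiscrimination_le`). For `(1 - 2δ)² k ≤ 1` these weights add up to at most one
over all inputs, so that one of `n` inputs has weight at most `1 / n`. A circuit for the disjunction
must however notice a change of any input from the zero vector, with an advantage that does not
depend on `n`.

*Lower bound.* A Boolean function of `j + 1` variables branches on the last one into two functions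
of `j` variables. A gate that reads this variable, together with the outputs of `m` disjoint copies
of a circuit for each of the two functions, returns the majority vote of the copies that matter. If
the outputs have bias `β = (1 - 2δ) / 2`, then a Chernoff bound shows that the vote is wrong with
probability at most `exp (-m β² / 2)`. This is at most `1 / 4` if `m (1 - 2δ)² ≥ 24`, and the noise
of the gate then leaves a bias of at least `β` (`reliableComputation_of_le`). Since the copies are
disjoint, they are independent, and with `m` about `k / 2` the condition holds for
`δ ≤ 1 / 2 - 5 / √k`.
-/

/-! ### Triangular discrimination -/

section Divergence

variable {Ω T S : Type*} [Fintype Ω] [DecidableEq T] [DecidableEq S]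

/-- The law of the random variable `X` on the finite space `Ω` with point masses `P`. -/
def law (P : Ω → ℝ) (X : Ω → T) (t : T) : ℝ :=
  ∑ ω, if X ω = t then P ω else 0

/-- The triangular discrimination `∑ (p - q)² / (p + q)` between the laws of `X` and `Y`. Points
that neither law charges contribute `0 / 0 = 0`, as they should. -/
noncomputable def discrimination [Fintype T] (P : Ω → ℝ) (X Y : Ω → T) : ℝ :=
  ∑ t, (law P X t - law P Y t) ^ 2 / (law P X t + law P Y t)

theorem law_nonneg {P : Ω → ℝ} (hP : ∀ ω, 0 ≤ P ω) (X : Ω → T) (t : T) : 0 ≤ law P X t :=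
  Finset.sum_nonneg fun ω _ => by split_ifs <;> simp [hP]

theorem sum_law [Fintype T] (P : Ω → ℝ) (X : Ω → T) : ∑ t, law P X t = ∑ ω, P ω := by
  unfold law
  rw [Finset.sum_comm]
  simp

theorem law_comp [Fintype T] (P : Ω → ℝ) (X : Ω → T) (φ : T → S) (u : S) :
    law P (fun ω => φ (X ω)) u = ∑ t with φ t = u, law P X t := by
  unfold law
  rw [Finset.sum_comm]
  refine Finset.sum_congr rfl fun ω _ => ?_
  rw [Finset.sum_ite_eq]
  simp

/-- Sedrakyan's form of the Cauchy–Schwarz inequality, where denominators may vanish along with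
the numerators. -/
theorem sq_sum_div_le_sum_sq_div_of_abs_le {ι : Type*} (s : Finset ι) (d w : ι → ℝ)
    (h : ∀ i, |d i| ≤ w i) :
    (∑ i ∈ s, d i) ^ 2 / ∑ i ∈ s, w i ≤ ∑ i ∈ s, d i ^ 2 / w i := by
  have hw : ∀ i, 0 ≤ w i := fun i => (abs_nonneg _).trans (h i)
  have hf : ∀ i, 0 ≤ d i ^ 2 / w i := fun i => div_nonneg (sq_nonneg _) (hw i)
  refine div_le_of_le_mul₀ (Finset.sum_nonneg fun i _ => hw i)
    (Finset.sum_nonneg fun i _ => hf i) ?_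
  refine Finset.sum_sq_le_sum_mul_sum_of_sq_le_mul s (fun i _ => hf i) (fun i _ => hw i) ?_
  intro i _
  rcases eq_or_ne (w i) 0 with h0 | h0
  · have : d i = 0 := abs_nonpos_iff.mp (h0 ▸ h i)
    simp [h0, this]
  · exact (div_mul_cancel₀ _ h0).ge

theorem abs_sub_le_add_of_nonneg {p q : ℝ} (hp : 0 ≤ p) (hq : 0 ≤ q) : |p - q| ≤ p + q := by
  rw [abs_le]
  constructor <;> linarith

/-- The data processing inequality. -/
theorem discrimination_comp_le [Fintype T] [Fintype S] {P : Ω → ℝ} (hP : ∀ ω, 0 ≤ P ω)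
    (X Y : Ω → T) (φ : T → S) :
    discrimination P (fun ω => φ (X ω)) (fun ω => φ (Y ω)) ≤ discrimination P X Y := by
  unfold discrimination
  rw [← Finset.sum_fiberwise Finset.univ φ]
  refine Finset.sum_le_sum fun u _ => ?_
  rw [law_comp, law_comp, ← Finset.sum_sub_distrib, ← Finset.sum_add_distrib]
  exact sq_sum_div_le_sum_sq_div_of_abs_le _ _ _ fun t =>
    abs_sub_le_add_of_nonneg (law_nonneg hP _ _) (law_nonneg hP _ _)

theorem discrimination_le_two [Fintype T] {P : Ω → ℝ} (hP : ∀ ω, 0 ≤ P ω) (h1 : ∑ ω, P ω = 1)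
    (X Y : Ω → T) : discrimination P X Y ≤ 2 := by
  have key : ∀ t, (law P X t - law P Y t) ^ 2 / (law P X t + law P Y t)
      ≤ law P X t + law P Y t := fun t => by
    have hp := law_nonneg hP X t
    have hq := law_nonneg hP Y t
    refine div_le_of_le_mul₀ (by positivity) (by positivity) ?_
    nlinarith [mul_nonneg hp hq]
  refine (Finset.sum_le_sum fun t _ => key t).trans ?_
  rw [Finset.sum_add_distrib, sum_law, sum_law, h1]
  norm_num

theorem discrimination_self [Fintype T] (P : Ω → ℝ) (X : Ω → T) : discrimination P X X = 0 := by
  simp [discrimination]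

/-- The contraction of the triangular discrimination by a binary symmetric channel with crossover
probability `δ`. The excess of `∑ dᵢ² / sᵢ` over `(∑ dᵢ)² / ∑ sᵢ` is
`(d₀ s₁ - d₁ s₀)² / (s₀ s₁ (s₀ + s₁))`; the channel multiplies the base of the square by `1 - 2δ`
and does not decrease the product `s₀ s₁`. -/
theorem noise_contraction {δ d₀ d₁ s₀ s₁ : ℝ} (hδ : 0 ≤ δ) (hδ' : δ ≤ 1 / 2)
    (h₀ : |d₀| ≤ s₀) (h₁ : |d₁| ≤ s₁) :
    ((1 - δ) * d₀ + δ * d₁) ^ 2 / ((1 - δ) * s₀ + δ * s₁)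
      + ((1 - δ) * d₁ + δ * d₀) ^ 2 / ((1 - δ) * s₁ + δ * s₀)
    ≤ (1 - (1 - 2 * δ) ^ 2) * ((d₀ + d₁) ^ 2 / (s₀ + s₁))
      + (1 - 2 * δ) ^ 2 * (d₀ ^ 2 / s₀ + d₁ ^ 2 / s₁) := by
  have hs₀ : 0 ≤ s₀ := (abs_nonneg _).trans h₀
  have hs₁ : 0 ≤ s₁ := (abs_nonneg _).trans h₁
  have scale : ∀ c d s : ℝ, (c * d) ^ 2 / (c * s) = c * (d ^ 2 / s) := fun c d s => by
    rcases eq_or_ne c 0 with rfl | hc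
    · simp
    · rw [mul_pow, sq c, mul_assoc, mul_div_mul_left _ _ hc, mul_div_assoc]
  rcases hs₀.eq_or_lt with rfl | p₀
  · obtain rfl : d₀ = 0 := abs_nonpos_iff.mp h₀
    simp only [mul_zero, zero_add, add_zero, scale]
    apply le_of_eq
    simp
    ring
  rcases hs₁.eq_or_lt with rfl | p₁
  · obtain rfl : d₁ = 0 := abs_nonpos_iff.mp h₁
    simp only [mul_zero, zero_add, add_zero, scale]
    apply le_of_eq
    simp
    ring
  have excess : ∀ a b s t : ℝ, 0 < s → 0 < t →
      a ^ 2 / s + b ^ 2 / t = (a + b) ^ 2 / (s + t) + (a * t - b * s) ^ 2 / (s * t * (s + t)) := by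
    intro a b s t hs ht
    field_simp
    ring
  have q₀ : 0 < (1 - δ) * s₀ + δ * s₁ := by nlinarith [mul_nonneg hδ hs₁]
  have q₁ : 0 < (1 - δ) * s₁ + δ * s₀ := by nlinarith [mul_nonneg hδ hs₀]
  rw [excess _ _ _ _ q₀ q₁, excess _ _ _ _ p₀ p₁]
  have hd : (1 - δ) * d₀ + δ * d₁ + ((1 - δ) * d₁ + δ * d₀) = d₀ + d₁ := by ring
  have hs : (1 - δ) * s₀ + δ * s₁ + ((1 - δ) * s₁ + δ * s₀) = s₀ + s₁ := by ring
  have hn : ((1 - δ) * d₀ + δ * d₁) * ((1 - δ) * s₁ + δ * s₀)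
      - ((1 - δ) * d₁ + δ * d₀) * ((1 - δ) * s₀ + δ * s₁)
      = (1 - 2 * δ) * (d₀ * s₁ - d₁ * s₀) := by ring
  rw [hd, hs, hn]
  have hprod : s₀ * s₁ ≤ ((1 - δ) * s₀ + δ * s₁) * ((1 - δ) * s₁ + δ * s₀) := by
    have : 0 ≤ δ * (1 - δ) * (s₀ - s₁) ^ 2 :=
      mul_nonneg (mul_nonneg hδ (by linarith)) (sq_nonneg _)
    nlinarith
  have hfrac : ((1 - 2 * δ) * (d₀ * s₁ - d₁ * s₀)) ^ 2
        / (((1 - δ) * s₀ + δ * s₁) * ((1 - δ) * s₁ + δ * s₀) * (s₀ + s₁))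
      ≤ (1 - 2 * δ) ^ 2 * ((d₀ * s₁ - d₁ * s₀) ^ 2 / (s₀ * s₁ * (s₀ + s₁))) := by
    rw [mul_pow, ← mul_div_assoc]
    gcongr
  linarith

end Divergence

/-! ### Noise at a single gate -/

namespace BooleanCircuit

variable {n : ℕ}

theorem patternProb_nonneg (C : BooleanCircuit n) {δ : ℝ} (hδ : 0 ≤ δ) (hδ' : δ ≤ 1 / 2)
    (e : C.Gate → Bool) : 0 ≤ C.patternProb δ e :=
  Finset.prod_nonneg fun g _ => by split_ifs <;> linarith

theorem sum_patternProb (C : BooleanCircuit n) (δ : ℝ) : ∑ e, C.patternProb δ e = 1 := by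
  unfold patternProb
  have h := Finset.prod_univ_sum (fun _ : C.Gate => (Finset.univ : Finset Bool))
    (fun _ b => if b = true then δ else 1 - δ)
  rw [Fintype.piFinset_univ] at h
  rw [← h]
  simp

/-- Conditioning on whether the gate `v` malfunctions: an average over malfunction patterns is the
mixture of the averages where `v` works and where it fails. -/
theorem sum_patternProb_update (C : BooleanCircuit n) (δ : ℝ) (v : C.Gate)
    (F : (C.Gate → Bool) → ℝ) :
    ∑ e, C.patternProb δ e * F e
      = ∑ e, C.patternProb δ e *
        ((1 - δ) * F (Function.update e v false) + δ * F (Function.update e v true)) := by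
  have hsplit : ∀ G : (C.Gate → Bool) → ℝ, ∑ e, G e
      = ∑ r : ({j // j ≠ v} → Bool), (G ((Equiv.funSplitAt v Bool).symm (false, r))
        + G ((Equiv.funSplitAt v Bool).symm (true, r))) := fun G => by
    rw [← (Equiv.funSplitAt v Bool).symm.sum_comp G, Fintype.sum_prod_type_right]
    simp [add_comm]
  have hP : ∀ b (r : {j // j ≠ v} → Bool),
      C.patternProb δ ((Equiv.funSplitAt v Bool).symm (b, r))
        = (if b = true then δ else 1 - δ) * ∏ j, (if r j = true then δ else 1 - δ) := by
    intro b r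
    unfold patternProb
    rw [Fintype.prod_eq_mul_prod_subtype_ne _ v]
    congr 1
    · simp [Equiv.funSplitAt, Equiv.piSplitAt]
    · refine Finset.prod_congr rfl fun j _ => ?_
      simp [Equiv.funSplitAt, Equiv.piSplitAt, j.2]
  have hU : ∀ b c (r : {j // j ≠ v} → Bool),
      Function.update ((Equiv.funSplitAt v Bool).symm (b, r)) v c
        = (Equiv.funSplitAt v Bool).symm (c, r) := by
    intro b c r
    funext j
    by_cases hj : j = v
    · subst hj
      simp [Equiv.funSplitAt, Equiv.piSplitAt]
    · simp [Equiv.funSplitAt, Equiv.piSplitAt, hj]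
  rw [hsplit, hsplit]
  refine Finset.sum_congr rfl fun r _ => ?_
  simp only [hP, hU]
  simp
  ring

section Noise

variable {T : Type*} [DecidableEq T]

theorem law_noise (C : BooleanCircuit n) (δ : ℝ) (v : C.Gate) (X : (C.Gate → Bool) → T)
    (U : (C.Gate → Bool) → Bool) (hX : ∀ e b, X (Function.update e v b) = X e)
    (hU : ∀ e b, U (Function.update e v b) = U e) (t : T) (b : Bool) :
    law (C.patternProb δ) (fun e => (X e, xor (e v) (U e))) (t, b)
      = (1 - δ) * law (C.patternProb δ) (fun e => (X e, U e)) (t, b)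
        + δ * law (C.patternProb δ) (fun e => (X e, U e)) (t, !b) := by
  have h := C.sum_patternProb_update δ v
    (fun e => if (X e, xor (e v) (U e)) = (t, b) then 1 else 0)
  simp only [mul_ite, mul_one, mul_zero, hX, hU, Function.update_self] at h
  unfold law
  rw [h, Finset.mul_sum, Finset.mul_sum, ← Finset.sum_add_distrib]
  refine Finset.sum_congr rfl fun e _ => ?_
  by_cases hx : X e = t <;> rcases hu : U e <;> cases b <;> simp [hx, hu, mul_comm]

theorem law_fst_eq {Ω : Type*} [Fintype Ω] (P : Ω → ℝ) (X : Ω → T) (U : Ω → Bool) (t : T) :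
    law P X t = law P (fun ω => (X ω, U ω)) (t, false) + law P (fun ω => (X ω, U ω)) (t, true) := by
  unfold law
  rw [← Finset.sum_add_distrib]
  refine Finset.sum_congr rfl fun e _ => ?_
  by_cases hx : X e = t <;> rcases hu : U e <;> simp [hx, hu]

/-- The strong data processing inequality for one noisy gate: observing the output of the gate
`v` on top of `X` helps as much as observing its noiseless output `U` with probability
`(1 - 2δ)²`. -/
theorem discrimination_noise_le [Fintype T] (C : BooleanCircuit n) {δ : ℝ} (hδ : 0 ≤ δ)
    (hδ' : δ ≤ 1 / 2) (v : C.Gate) (X Y : (C.Gate → Bool) → T) (U V : (C.Gate → Bool) → Bool)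
    (hX : ∀ e b, X (Function.update e v b) = X e) (hY : ∀ e b, Y (Function.update e v b) = Y e)
    (hU : ∀ e b, U (Function.update e v b) = U e) (hV : ∀ e b, V (Function.update e v b) = V e) :
    discrimination (C.patternProb δ) (fun e => (X e, xor (e v) (U e)))
        (fun e => (Y e, xor (e v) (V e)))
      ≤ (1 - (1 - 2 * δ) ^ 2) * discrimination (C.patternProb δ) X Y
        + (1 - 2 * δ) ^ 2 *
          discrimination (C.patternProb δ) (fun e => (X e, U e)) (fun e => (Y e, V e)) := by
  unfold discrimination
  rw [Fintype.sum_prod_type, Fintype.sum_prod_type, Finset.mul_sum, Finset.mul_sum,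
    ← Finset.sum_add_distrib]
  refine Finset.sum_le_sum fun t _ => ?_
  rw [law_fst_eq _ X U, law_fst_eq _ Y V]
  simp only [Fintype.sum_bool, C.law_noise δ v X U hX hU, C.law_noise δ v Y V hY hV,
    Bool.not_true, Bool.not_false]
  have hl := fun (Z : (C.Gate → Bool) → T × Bool) => law_nonneg (C.patternProb_nonneg hδ hδ') Z
  have key := noise_contraction hδ hδ'
    (abs_sub_le_add_of_nonneg (hl (fun e => (X e, U e)) (t, false))
      (hl (fun e => (Y e, V e)) (t, false)))
    (abs_sub_le_add_of_nonneg (hl (fun e => (X e, U e)) (t, true))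
      (hl (fun e => (Y e, V e)) (t, true)))
  ring_nf at key ⊢
  linarith

end Noise

/-! ### Path weights and percolation -/

/-- The total weight of the paths from the input `i` to the gate `g`, where a path through `ℓ`
gates has weight `η ^ ℓ`. -/
noncomputable def pathWeight (C : BooleanCircuit n) (η : ℝ) (i : Fin n) : C.Gate → ℝ :=
  C.acyclic.fix fun g ih => η * ∑ a,
    match hs : C.wire g a with
    | WireSource.const _ => 0
    | WireSource.input j => if j = i then 1 else 0
    | WireSource.gate h => ih h ⟨a, hs⟩

theorem pathWeight_eq (C : BooleanCircuit n) (η : ℝ) (i : Fin n) (g : C.Gate) :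
    C.pathWeight η i g = η * ∑ a,
      match C.wire g a with
      | WireSource.const _ => 0
      | WireSource.input j => if j = i then 1 else 0
      | WireSource.gate h => C.pathWeight η i h := by
  unfold pathWeight
  rw [WellFounded.fix_eq]
  congr 2
  funext a
  split <;> rename_i hs <;> simp [hs]

theorem pathWeight_nonneg (C : BooleanCircuit n) {η : ℝ} (hη : 0 ≤ η) (i : Fin n) (g : C.Gate) :
    0 ≤ C.pathWeight η i g := by
  induction g using C.acyclic.induction with
  | _ g ih =>
    rw [pathWeight_eq]
    refine mul_nonneg hη (Finset.sum_nonneg fun a _ => ?_)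
    split
    · rfl
    · split_ifs <;> simp
    · next h hs => exact ih h ⟨a, hs⟩

theorem sum_pathWeight_le_one (C : BooleanCircuit n) {η : ℝ} (hη : 0 ≤ η) {k : ℕ}
    (hC : C.FanInLE k) (hk : η * k ≤ 1) (g : C.Gate) : ∑ i, C.pathWeight η i g ≤ 1 := by
  induction g using C.acyclic.induction with
  | _ g ih =>
    simp_rw [C.pathWeight_eq η _ g]
    rw [← Finset.mul_sum, Finset.sum_comm]
    have hle : ∀ a ∈ (Finset.univ : Finset (Fin (C.fanIn g))), (∑ i, match C.wire g a with
        | WireSource.const _ => (0 : ℝ)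
        | WireSource.input j => if j = i then 1 else 0
        | WireSource.gate h => C.pathWeight η i h) ≤ 1 := by
      intro a _
      rcases hs : C.wire g a with b | j | h
      · simp
      · simp
      · exact ih h ⟨a, hs⟩
    calc _ ≤ η * ∑ _a : Fin (C.fanIn g), (1 : ℝ) := by gcongr with a ha; exact hle a ha
      _ = η * C.fanIn g := by simp
      _ ≤ η * k := by gcongr; exact hC g
      _ ≤ 1 := hk

/-- The correct value of the gate `g` for inputs that it receives when the gates send out `z`. -/
def gateOp (C : BooleanCircuit n) (x : Fin n → Bool) (g : C.Gate) (z : C.Gate → Bool) : Bool :=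
  C.op g fun a =>
    match C.wire g a with
    | WireSource.const b => b
    | WireSource.input i => x i
    | WireSource.gate h => z h

theorem value_eq_gateOp (C : BooleanCircuit n) (x : Fin n → Bool) (e : C.Gate → Bool)
    (g : C.Gate) : C.value x e g = xor (e g) (C.gateOp x g (C.value x e)) :=
  C.value_eq x e g

/-- The gates whose output is an input of the gate `g`. -/
noncomputable def parents (C : BooleanCircuit n) (g : C.Gate) : Finset C.Gate :=
  open Classical in {h | ∃ a, C.wire g a = WireSource.gate h}

theorem mem_parents (C : BooleanCircuit n) {g h : C.Gate} :
    h ∈ C.parents g ↔ ∃ a, C.wire g a = WireSource.gate h := by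
  simp [parents]

theorem gateOp_congr (C : BooleanCircuit n) {x y : Fin n → Bool} {g : C.Gate}
    {z w : C.Gate → Bool} (hxy : ∀ j a, C.wire g a = WireSource.input j → x j = y j)
    (hzw : ∀ h ∈ C.parents g, z h = w h) : C.gateOp x g z = C.gateOp y g w := by
  unfold gateOp
  congr 1
  funext a
  rcases hs : C.wire g a with b | j | h
  · rfl
  · exact hxy j a hs
  · exact hzw h (C.mem_parents.mpr ⟨a, hs⟩)

/-- The values of the gates in a set that contains its parents do not depend on malfunctions
outside of the set. -/
theorem value_update (C : BooleanCircuit n) (x : Fin n → Bool) {D : Finset C.Gate}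
    (hD : ∀ g ∈ D, C.parents g ⊆ D) {v : C.Gate} (hv : v ∉ D) (e : C.Gate → Bool) (b : Bool)
    (g : C.Gate) (hg : g ∈ D) : C.value x (Function.update e v b) g = C.value x e g := by
  induction g using C.acyclic.induction with
  | _ g ih =>
    rw [value_eq_gateOp, value_eq_gateOp C x e]
    congr 1
    · rw [Function.update_of_ne]
      rintro rfl
      exact hv hg
    · exact C.gateOp_congr (fun _ _ _ => rfl) fun h hh =>
        ih h (C.mem_parents.mp hh) (hD g hg hh)

/-- The restriction of an assignment to `A`, extended by `false`. -/
def mask {G : Type*} [DecidableEq G] (A : Finset G) (z : G → Bool) (g : G) : Bool :=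
  if g ∈ A then z g else false

/-- The triangular discrimination between the joint laws of the outputs of the gates in `A` on the
inputs `x` and `y`. -/
noncomputable def gateDiscrimination (C : BooleanCircuit n) (δ : ℝ) (x y : Fin n → Bool)
    (A : Finset C.Gate) : ℝ :=
  discrimination (C.patternProb δ) (fun e => mask A (C.value x e)) (fun e => mask A (C.value y e))

/-- The paths from `i` to `v` include the extensions by `v` of those to the parents of `v`. -/
theorem sum_parents_le (C : BooleanCircuit n) {η : ℝ} (hη : 0 ≤ η) (i : Fin n) (v : C.Gate) :
    η * ∑ h ∈ C.parents v, C.pathWeight η i h ≤ C.pathWeight η i v := by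
  rw [C.pathWeight_eq η i v]
  gcongr
  have hex : ∀ h : C.Gate, ∃ a, h ∈ C.parents v → C.wire v a = WireSource.gate h := fun h => by
    by_cases hh : h ∈ C.parents v
    · obtain ⟨a, ha⟩ := C.mem_parents.mp hh
      exact ⟨a, fun _ => ha⟩
    · exact ⟨⟨0, C.fanIn_pos v⟩, fun h' => absurd h' hh⟩
  choose r hr using hex
  have hinj : Set.InjOn r (C.parents v) := fun h hh h' hh' he => by
    have h1 := hr h hh
    rw [he, hr h' hh'] at h1
    exact (WireSource.gate.inj h1).symm
  calc ∑ h ∈ C.parents v, C.pathWeight η i h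
      = ∑ h ∈ C.parents v, (match C.wire v (r h) with
          | WireSource.const _ => 0
          | WireSource.input j => if j = i then 1 else 0
          | WireSource.gate h => C.pathWeight η i h) :=
        Finset.sum_congr rfl fun h hh => by rw [hr h hh]
    _ = ∑ a ∈ (C.parents v).image r, (match C.wire v a with
          | WireSource.const _ => 0
          | WireSource.input j => if j = i then 1 else 0
          | WireSource.gate h => C.pathWeight η i h) := by
        rw [Finset.sum_image hinj]
    _ ≤ _ := by
        refine Finset.sum_le_sum_of_subset_of_nonneg (Finset.subset_univ _) fun a _ _ => ?_
        split
        · rfl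
        · split_ifs <;> simp
        · exact C.pathWeight_nonneg hη i _

theorem le_pathWeight (C : BooleanCircuit n) {η : ℝ} (hη : 0 ≤ η) {i : Fin n} {v : C.Gate}
    {a : Fin (C.fanIn v)} (ha : C.wire v a = WireSource.input i) : η ≤ C.pathWeight η i v := by
  rw [C.pathWeight_eq η i v]
  refine le_mul_of_one_le_right hη ?_
  refine le_trans (le_of_eq ?_) (Finset.single_le_sum (fun a _ => ?_) (Finset.mem_univ a))
  · simp [ha]
  · split
    · rfl
    · split_ifs <;> simp
    · exact C.pathWeight_nonneg hη i _

/-- One step of the percolation argument: observing a further gate `v` besides `B` helps as much as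
observing its noiseless output with probability `(1 - 2δ)²`. -/
theorem gateDiscrimination_insert_le (C : BooleanCircuit n) {δ : ℝ} (hδ : 0 ≤ δ)
    (hδ' : δ ≤ 1 / 2) (x y : Fin n → Bool) {D B : Finset C.Gate}
    (hD : ∀ g ∈ D, C.parents g ⊆ D) {v : C.Gate} (hv : v ∉ D) (hvD : C.parents v ⊆ D)
    (hB : B ⊆ D) :
    C.gateDiscrimination δ x y (insert v B)
      ≤ (1 - (1 - 2 * δ) ^ 2) * C.gateDiscrimination δ x y B
        + (1 - 2 * δ) ^ 2 * discrimination (C.patternProb δ)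
          (fun e => (mask B (C.value x e), C.gateOp x v (C.value x e)))
          (fun e => (mask B (C.value y e), C.gateOp y v (C.value y e))) := by
  have hmask : ∀ x e b, mask B (C.value x (Function.update e v b)) = mask B (C.value x e) := by
    intro x e b
    funext g
    unfold mask
    split_ifs with hg
    · exact C.value_update x hD hv e b g (hB hg)
    · rfl
  have hop : ∀ x e b, C.gateOp x v (C.value x (Function.update e v b))
      = C.gateOp x v (C.value x e) := fun x e b =>
    C.gateOp_congr (fun _ _ _ => rfl) fun h hh => C.value_update x hD hv e b h (hvD hh)
  have hins : ∀ x e, mask (insert v B) (C.value x e)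
      = (fun p : (C.Gate → Bool) × Bool => Function.update p.1 v p.2)
        (mask B (C.value x e), xor (e v) (C.gateOp x v (C.value x e))) := by
    intro x e
    funext g
    rw [← value_eq_gateOp]
    by_cases hg : g = v
    · subst hg
      simp [mask]
    · simp [mask, hg]
  refine le_trans ?_ (C.discrimination_noise_le hδ hδ' v (fun e => mask B (C.value x e))
    (fun e => mask B (C.value y e)) (fun e => C.gateOp x v (C.value x e))
    (fun e => C.gateOp y v (C.value y e)) (hmask x) (hmask y) (hop x) (hop y))
  unfold gateDiscrimination
  simp only [hins]
  exact discrimination_comp_le (C.patternProb_nonneg hδ hδ')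
    (fun e => (mask B (C.value x e), xor (e v) (C.gateOp x v (C.value x e))))
    (fun e => (mask B (C.value y e), xor (e v) (C.gateOp y v (C.value y e))))
    (fun p : (C.Gate → Bool) × Bool => Function.update p.1 v p.2)

theorem discrimination_gateOp_le (C : BooleanCircuit n) {δ : ℝ} (hδ : 0 ≤ δ) (hδ' : δ ≤ 1 / 2)
    {x y : Fin n → Bool} (B : Finset C.Gate) {v : C.Gate}
    (hxy : ∀ j a, C.wire v a = WireSource.input j → x j = y j) :
    discrimination (C.patternProb δ)
        (fun e => (mask B (C.value x e), C.gateOp x v (C.value x e)))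
        (fun e => (mask B (C.value y e), C.gateOp y v (C.value y e)))
      ≤ C.gateDiscrimination δ x y (B ∪ C.parents v) := by
  -- As `x` and `y` agree on the inputs that `v` reads, the operation may use `x` in both cases.
  have hpar : ∀ z, (∀ j a, C.wire v a = WireSource.input j → x j = z j) → ∀ e,
      (mask B (C.value z e), C.gateOp z v (C.value z e))
        = (fun w => (mask B w, C.gateOp x v w)) (mask (B ∪ C.parents v) (C.value z e)) := by
    intro z hz e
    refine Prod.ext ?_ ?_
    · funext g
      by_cases hg : g ∈ B <;> simp [mask, hg]
    · exact (C.gateOp_congr hz fun h hh => by simp [mask, hh]).symm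
  simp only [hpar x fun _ _ _ => rfl, hpar y hxy]
  exact discrimination_comp_le (C.patternProb_nonneg hδ hδ')
    (fun e => mask (B ∪ C.parents v) (C.value x e))
    (fun e => mask (B ∪ C.parents v) (C.value y e)) fun w => (mask B w, C.gateOp x v w)

/-- A gate that no other gate of a nonempty set `D` reads. -/
theorem exists_last (C : BooleanCircuit n) {D : Finset C.Gate} (hne : D.Nonempty) :
    ∃ v ∈ D, ∀ g ∈ D, v ∉ C.parents g := by
  let r := fun h g : C.Gate => ∃ a, C.wire g a = WireSource.gate h
  have : IsWellFounded C.Gate r := ⟨C.acyclic⟩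
  obtain ⟨v, hv, hmax⟩ := Finset.exists_max_image D (IsWellFounded.rank r) hne
  exact ⟨v, hv, fun g hg hp =>
    (hmax g hg).not_gt (IsWellFounded.rank_lt_of_rel (r := r) (C.mem_parents.mp hp))⟩

/-- If `x` and `y` only differ at `i`, the outputs of the gates in `A` distinguish them at most as
well as the total weight of the paths from the input `i` to `A` allows. -/
theorem gateDiscrimination_le (C : BooleanCircuit n) {δ : ℝ} (hδ : 0 ≤ δ) (hδ' : δ ≤ 1 / 2)
    {x y : Fin n → Bool} {i : Fin n} (hxy : ∀ j ≠ i, x j = y j) (A : Finset C.Gate) :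
    C.gateDiscrimination δ x y A ≤ 2 * ∑ g ∈ A, C.pathWeight ((1 - 2 * δ) ^ 2) i g := by
  have hη : 0 ≤ (1 - 2 * δ) ^ 2 := sq_nonneg _
  have hη' : (1 - 2 * δ) ^ 2 ≤ 1 := by nlinarith
  suffices H : ∀ D : Finset C.Gate, (∀ g ∈ D, C.parents g ⊆ D) → ∀ A ⊆ D,
      C.gateDiscrimination δ x y A ≤ 2 * ∑ g ∈ A, C.pathWeight ((1 - 2 * δ) ^ 2) i g from
    H Finset.univ (fun _ _ => Finset.subset_univ _) A (Finset.subset_univ _)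
  intro D
  induction D using Finset.strongInduction with
  | H D ih =>
    intro hD A hA
    rcases D.eq_empty_or_nonempty with rfl | hne
    · obtain rfl := Finset.subset_empty.mp hA
      have h0 : ∀ z : C.Gate → Bool, mask ∅ z = fun _ => false := fun z => by
        funext g
        simp [mask]
      simp [gateDiscrimination, h0, discrimination_self]
    obtain ⟨v, hvD, hlast⟩ := C.exists_last hne
    have hD' : ∀ g ∈ D.erase v, C.parents g ⊆ D.erase v := fun g hg h hh =>
      Finset.mem_erase.mpr ⟨fun he => hlast g (Finset.mem_of_mem_erase hg) (he ▸ hh),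
        hD g (Finset.mem_of_mem_erase hg) hh⟩
    have hpar : C.parents v ⊆ D.erase v := fun h hh =>
      Finset.mem_erase.mpr ⟨fun he => hlast v hvD (he ▸ hh), hD v hvD hh⟩
    have IH := ih (D.erase v) (Finset.erase_ssubset hvD) hD'
    by_cases hvA : v ∈ A
    swap
    · exact IH A (Finset.subset_erase.mpr ⟨hA, hvA⟩)
    have hB : A.erase v ⊆ D.erase v := Finset.erase_subset_erase v hA
    rw [← Finset.insert_erase hvA, Finset.sum_insert (Finset.notMem_erase v A)]
    generalize A.erase v = B at hB
    have h1 := IH B hB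
    have h5 := C.gateDiscrimination_insert_le hδ hδ' x y hD' (Finset.notMem_erase v D) hpar hB
    have h6 := mul_le_mul_of_nonneg_left h1 (sub_nonneg.mpr hη')
    by_cases hi : ∃ a, C.wire v a = WireSource.input i
    · -- The parents of `v` may reveal all about the input `i`, but `v` itself then has weight
      -- at least `(1 - 2δ)²`.
      obtain ⟨a, ha⟩ := hi
      have hw := C.le_pathWeight hη ha
      have h7 := mul_le_mul_of_nonneg_left (discrimination_le_two
        (C.patternProb_nonneg hδ hδ') (C.sum_patternProb δ)
        (fun e => (mask B (C.value x e), C.gateOp x v (C.value x e)))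
        (fun e => (mask B (C.value y e), C.gateOp y v (C.value y e)))) hη
      have h8 : 0 ≤ (1 - 2 * δ) ^ 2 * ∑ g ∈ B, C.pathWeight ((1 - 2 * δ) ^ 2) i g :=
        mul_nonneg hη (Finset.sum_nonneg fun g _ => C.pathWeight_nonneg hη i g)
      linarith
    · have hag : ∀ j a, C.wire v a = WireSource.input j → x j = y j := fun j a ha =>
        hxy j fun hj => hi ⟨a, hj ▸ ha⟩
      have h2 := IH (B ∪ C.parents v) (Finset.union_subset hB hpar)
      have h3 : ∑ g ∈ B ∪ C.parents v, C.pathWeight ((1 - 2 * δ) ^ 2) i g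
          ≤ ∑ g ∈ B, C.pathWeight ((1 - 2 * δ) ^ 2) i g
            + ∑ g ∈ C.parents v, C.pathWeight ((1 - 2 * δ) ^ 2) i g := by
        rw [← Finset.sum_union_inter]
        exact le_add_of_nonneg_right (Finset.sum_nonneg fun g _ => C.pathWeight_nonneg hη i g)
      have h4 := C.sum_parents_le hη i v
      have h8 := C.discrimination_gateOp_le hδ hδ' B hag
      have h7 := mul_le_mul_of_nonneg_left
        (h8.trans (h2.trans (mul_le_mul_of_nonneg_left h3 zero_le_two))) hη
      linarith

/-- The two outcomes of the output bit, wrong and right, each contribute at least half of the squared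
difference of the error probabilities. -/
theorem errorProb_sub_sq_le (C : BooleanCircuit n) {δ : ℝ} (hδ : 0 ≤ δ) (hδ' : δ ≤ 1 / 2)
    (x y : Fin n → Bool) (b : Bool) :
    (C.errorProb δ x b - C.errorProb δ y b) ^ 2 ≤ C.gateDiscrimination δ x y {C.out} := by
  have hP := C.patternProb_nonneg hδ hδ'
  have hout : ∀ z e, decide (C.value z e C.out ≠ b)
      = (fun w : C.Gate → Bool => decide (w C.out ≠ b)) (mask {C.out} (C.value z e)) := by
    intro z e
    simp [mask]
  have herr : ∀ z, law (C.patternProb δ) (fun e => decide (C.value z e C.out ≠ b)) true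
      = C.errorProb δ z b := by
    intro z
    simp [law, errorProb]
  have htot : ∀ z, law (C.patternProb δ) (fun e => decide (C.value z e C.out ≠ b)) true
      + law (C.patternProb δ) (fun e => decide (C.value z e C.out ≠ b)) false = 1 := by
    intro z
    rw [← C.sum_patternProb δ, ← sum_law _ fun e => decide (C.value z e C.out ≠ b),
      Fintype.sum_bool]
  have hnn := fun z => law_nonneg hP fun e => decide (C.value z e C.out ≠ b)
  have hmono : discrimination (C.patternProb δ) (fun e => decide (C.value x e C.out ≠ b))
      (fun e => decide (C.value y e C.out ≠ b)) ≤ C.gateDiscrimination δ x y {C.out} := by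
    simp only [hout]
    exact discrimination_comp_le hP (fun e => mask {C.out} (C.value x e))
      (fun e => mask {C.out} (C.value y e)) fun w => decide (w C.out ≠ b)
  refine le_trans ?_ hmono
  have hfac : ∀ p q : ℝ, 0 ≤ p → p ≤ 1 → 0 ≤ q → q ≤ 1 →
      (p - q) ^ 2 / 2 ≤ (p - q) ^ 2 / (p + q) := by
    intro p q hp hp' hq hq'
    rcases (add_nonneg hp hq).eq_or_lt with h | h
    · obtain rfl : p = 0 := by linarith
      obtain rfl : q = 0 := by linarith
      simp
    · exact div_le_div_of_nonneg_left (sq_nonneg _) h (by linarith)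
  have hx := htot x
  have hy := htot y
  have h1 := hfac _ _ (hnn x true) (by linarith [hnn x false]) (hnn y true)
    (by linarith [hnn y false])
  have h2 := hfac _ _ (hnn x false) (by linarith [hnn x true]) (hnn y false)
    (by linarith [hnn y true])
  have hneg : law (C.patternProb δ) (fun e => decide (C.value x e C.out ≠ b)) false
      - law (C.patternProb δ) (fun e => decide (C.value y e C.out ≠ b)) false
      = -(C.errorProb δ x b - C.errorProb δ y b) := by
    rw [← herr x, ← herr y]
    linarith
  rw [discrimination, Fintype.sum_bool]
  rw [hneg, neg_sq] at h2 ⊢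
  rw [herr, herr] at h1 ⊢
  linarith

end BooleanCircuit

/-- The Evans–Schulman bound. Since all path weights into a gate sum to at most one, some input of
a circuit with many inputs hardly influences the output, so that the circuit does not compute the
disjunction reliably near the zero input. -/
theorem not_reliableComputation {k : ℕ} {δ : ℝ} (hδ : 0 ≤ δ) (hδ' : δ ≤ 1 / 2)
    (hk : (1 - 2 * δ) ^ 2 * k ≤ 1) : ¬ ReliableComputation k δ := by
  rintro ⟨ε, hε, H⟩
  obtain ⟨n, hn⟩ := exists_nat_gt (2 / (2 * ε) ^ 2)
  have hn0 : (0 : ℝ) < n := lt_of_le_of_lt (by positivity) hn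
  obtain ⟨C, hC, herr⟩ := H n fun x => decide (∃ i, x i = true)
  have hη : 0 ≤ (1 - 2 * δ) ^ 2 := sq_nonneg _
  obtain ⟨i, hi⟩ : ∃ i, C.pathWeight ((1 - 2 * δ) ^ 2) i C.out ≤ 1 / n := by
    by_contra! hlt
    have hne : (Finset.univ : Finset (Fin n)).Nonempty :=
      ⟨⟨0, by exact_mod_cast hn0⟩, Finset.mem_univ _⟩
    have h1 := Finset.sum_lt_sum_of_nonempty hne fun i _ => hlt i
    have h2 := C.sum_pathWeight_le_one hη hC hk C.out
    simp only [Finset.sum_const, Finset.card_univ, Fintype.card_fin, nsmul_eq_mul] at h1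
    rw [mul_one_div_cancel hn0.ne'] at h1
    linarith
  let y : Fin n → Bool := Function.update (fun _ => false) i true
  have h0 := herr fun _ => false
  have h1 := herr y
  have hf0 : decide (∃ _ : Fin n, false = true) = false := by simp
  have hf1 : decide (∃ j, y j = true) = true := by
    simp only [decide_eq_true_eq]
    exact ⟨i, by simp [y]⟩
  simp only [hf0] at h0
  simp only [hf1] at h1
  have hcompl : C.errorProb δ y true + C.errorProb δ y false = 1 := by
    rw [← C.sum_patternProb δ]
    unfold BooleanCircuit.errorProb
    rw [← Finset.sum_add_distrib]
    refine Finset.sum_congr rfl fun e _ => ?_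
    rcases hv : C.value y e C.out <;> simp
  have hgap : (2 * ε) ^ 2 ≤ (C.errorProb δ (fun _ => false) false - C.errorProb δ y false) ^ 2 := by
    rw [sub_sq_comm]
    exact pow_le_pow_left₀ (by positivity) (by linarith) 2
  have hle := C.gateDiscrimination_le (x := fun _ => false) (y := y) (i := i) hδ hδ'
    (fun j hj => by simp [y, hj]) {C.out}
  rw [Finset.sum_singleton] at hle
  have := C.errorProb_sub_sq_le hδ hδ' (fun _ => false) y false
  rw [div_lt_iff₀ (by positivity)] at hn
  have h2 : (2 * ε) ^ 2 ≤ 2 * (1 / n) := by linarith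
  rw [mul_one_div, le_div_iff₀ hn0] at h2
  linarith

/-! ### Joining disjoint copies of circuits -/

/-- The image of a wire source under a map of the gates. -/
def WireSource.map {n : ℕ} {G H : Type} (φ : G → H) : WireSource n G → WireSource n H
  | const b => const b
  | input i => input i
  | gate g => gate (φ g)

theorem WireSource.map_eq_gate {n : ℕ} {G H : Type} {φ : G → H} {s : WireSource n G} {h : H} :
    s.map φ = WireSource.gate h ↔ ∃ g, s = WireSource.gate g ∧ φ g = h := by
  cases s <;> simp [WireSource.map]

namespace BooleanCircuit

variable {n : ℕ}

/-- The circuit that consists of a single gate, which has the constant `b` as its correct value. -/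
def constGate (n : ℕ) (b : Bool) : BooleanCircuit n where
  Gate := Unit
  fanIn _ := 1
  fanIn_pos _ := one_pos
  op _ _ := b
  wire _ _ := WireSource.const false
  acyclic := ⟨fun _ => ⟨_, fun _ h => by simp at h⟩⟩
  out := ()
  sink_iff _ := by simp

theorem errorProb_constGate (δ : ℝ) (x : Fin n → Bool) (b : Bool) :
    (constGate n b).errorProb δ x b = δ := by
  have h : (constGate n b).errorProb δ x b = ∑ e : Unit → Bool,
      if xor (e ()) b ≠ b then ∏ _g : Unit, (if e () = true then δ else 1 - δ) else 0 :=
    Finset.sum_congr rfl fun e _ => by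
      rw [value_eq]
      rfl
  rw [h, ← (Equiv.funUnique Unit Bool).symm.sum_comp]
  simp

section Tree

variable {K : ℕ} (C : Fin K → BooleanCircuit n) (i : Fin n) (φ : Bool → (Fin K → Bool) → Bool)

/-- The fan-in of the gates of `BooleanCircuit.join`. -/
def joinFanIn : Option (Σ j, (C j).Gate) → ℕ
  | none => K + 1
  | some g => (C g.1).fanIn g.2

/-- The wires of `BooleanCircuit.join`. -/
def joinWire : (g : Option (Σ j, (C j).Gate)) → Fin (joinFanIn C g) →
    WireSource n (Option (Σ j, (C j).Gate))
  | none => Fin.cons (WireSource.input i) fun j => WireSource.gate (some ⟨j, (C j).out⟩)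
  | some g => fun a => ((C g.1).wire g.2 a).map fun h => some ⟨g.1, h⟩

theorem joinWire_none_eq_gate {h : Option (Σ j, (C j).Gate)} :
    (∃ a, joinWire C i none a = WireSource.gate h) ↔ ∃ j, h = some ⟨j, (C j).out⟩ := by
  change (∃ a : Fin (K + 1), (Fin.cons (WireSource.input i)
    fun j => WireSource.gate (some ⟨j, (C j).out⟩) : Fin (K + 1) → WireSource n _) a
      = WireSource.gate h) ↔ _
  simp [Fin.exists_fin_succ, eq_comm]

theorem joinWire_some_eq_gate {j : Fin K} {g : (C j).Gate} {h : Option (Σ j, (C j).Gate)} :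
    (∃ a, joinWire C i (some ⟨j, g⟩) a = WireSource.gate h)
      ↔ ∃ g', (∃ a, (C j).wire g a = WireSource.gate g') ∧ h = some ⟨j, g'⟩ := by
  change (∃ a : Fin ((C j).fanIn g), ((C j).wire g a).map _ = WireSource.gate h) ↔ _
  simp only [WireSource.map_eq_gate]
  constructor
  · rintro ⟨a, g', ha, rfl⟩
    exact ⟨g', ⟨a, ha⟩, rfl⟩
  · rintro ⟨g', ⟨a, ha⟩, rfl⟩
    exact ⟨a, g', ha, rfl⟩

/-- The circuit in which a new output gate, with operation `φ`, reads the input `i` and the outputs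
of disjoint copies of the circuits `C j`. The gate `none` is the new one. -/
def join : BooleanCircuit n where
  Gate := Option (Σ j, (C j).Gate)
  fanIn := joinFanIn C
  fanIn_pos
    | none => K.succ_pos
    | some g => (C g.1).fanIn_pos g.2
  op
    | none => fun z : Fin (K + 1) → Bool => φ (z 0) fun j => z j.succ
    | some g => (C g.1).op g.2
  wire := joinWire C i
  acyclic := by
    have hsome : ∀ j g, Acc (fun h g => ∃ a, joinWire C i g a = WireSource.gate h)
        (some ⟨j, g⟩) := by
      intro j g
      induction g using (C j).acyclic.induction with
      | _ g ih =>
        refine ⟨_, fun h hh => ?_⟩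
        obtain ⟨g', hg', rfl⟩ := (joinWire_some_eq_gate C i).mp hh
        exact ih g' hg'
    refine ⟨fun g => ?_⟩
    rcases g with _ | ⟨j, g⟩
    · refine ⟨_, fun h hh => ?_⟩
      obtain ⟨j, rfl⟩ := (joinWire_none_eq_gate C i).mp hh
      exact hsome _ _
    · exact hsome j g
  out := none
  sink_iff := by
    rintro (_ | ⟨j, g⟩)
    · simp only [iff_true]
      rintro (_ | ⟨j, g⟩) a ha
      · obtain ⟨j, h⟩ := (joinWire_none_eq_gate C i).mp ⟨a, ha⟩
        cases h
      · obtain ⟨g', -, h⟩ := (joinWire_some_eq_gate C i).mp ⟨a, ha⟩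
        cases h
    · simp only [reduceCtorEq, iff_false, not_forall, not_not]
      by_cases hg : g = (C j).out
      · exact ⟨none, (joinWire_none_eq_gate C i).mpr ⟨j, by rw [hg]⟩⟩
      · have := mt ((C j).sink_iff g).mp hg
        push Not at this
        obtain ⟨h, hh⟩ := this
        exact ⟨some ⟨j, h⟩, (joinWire_some_eq_gate C i).mpr ⟨g, hh, rfl⟩⟩

theorem join_fanInLE {k : ℕ} (hC : ∀ j, (C j).FanInLE k) (hK : K + 1 ≤ k) :
    (join C i φ).FanInLE k := by
  rintro (_ | ⟨j, g⟩)
  · exact hK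
  · exact hC j g

theorem join_value_some (x : Fin n → Bool) (e : (join C i φ).Gate → Bool) (j : Fin K)
    (g : (C j).Gate) :
    (join C i φ).value x e (some ⟨j, g⟩) = (C j).value x (fun h => e (some ⟨j, h⟩)) g := by
  induction g using (C j).acyclic.induction with
  | _ g ih =>
    refine ((join C i φ).value_eq x e (some ⟨j, g⟩)).trans
      (Eq.trans ?_ ((C j).value_eq x (fun h => e (some ⟨j, h⟩)) g).symm)
    change xor (e (some ⟨j, g⟩)) ((C j).op g _) = _
    congr 2
    funext a
    have hwire : (join C i φ).wire (some ⟨j, g⟩) a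
        = ((C j).wire g a).map fun h => (some ⟨j, h⟩ : Option (Σ j, (C j).Gate)) := rfl
    rw [hwire]
    rcases hs : (C j).wire g a with b | l | h
    · rfl
    · rfl
    · exact ih h ⟨a, hs⟩

theorem join_value_out (x : Fin n → Bool) (e : (join C i φ).Gate → Bool) :
    (join C i φ).value x e (join C i φ).out = xor (e none)
      (φ (x i) fun j => (C j).value x (fun h => e (some ⟨j, h⟩)) (C j).out) := by
  rw [value_eq]
  simp only [← join_value_some C i φ]
  rfl

/-- Malfunction patterns of the joined circuit are independent patterns of the new gate and of the
copies. -/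
def joinPattern : ((join C i φ).Gate → Bool) ≃ Bool × ((j : Fin K) → (C j).Gate → Bool) where
  toFun e := (e none, fun j g => e (some ⟨j, g⟩))
  invFun p
    | none => p.1
    | some g => p.2 g.1 g.2
  left_inv e := by
    funext g
    rcases g with _ | g <;> rfl
  right_inv _ := rfl

theorem join_patternProb (δ : ℝ) (e : (join C i φ).Gate → Bool) :
    (join C i φ).patternProb δ e = (if e none = true then δ else 1 - δ)
      * ∏ j, (C j).patternProb δ fun g => e (some ⟨j, g⟩) := by
  change ∏ g : Option (Σ j, (C j).Gate), (if e g = true then δ else 1 - δ) = _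
  rw [Fintype.prod_option, Fintype.prod_sigma]
  rfl

theorem sum_prod_pattern (F : (j : Fin K) → ((C j).Gate → Bool) → ℝ) :
    ∑ E : (j : Fin K) → (C j).Gate → Bool, ∏ j, F j (E j) = ∏ j, ∑ e, F j e := by
  rw [Finset.prod_univ_sum, Fintype.piFinset_univ]

/-- The output is wrong if the new gate either receives inputs that mislead it and works, or
receives other inputs and fails. -/
theorem errorProb_join (δ : ℝ) (x : Fin n → Bool) (b : Bool) :
    (join C i φ).errorProb δ x b = δ + (1 - 2 * δ) *
      ∑ E : (j : Fin K) → (C j).Gate → Bool,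
        (if φ (x i) (fun j => (C j).value x (E j) (C j).out) ≠ b then 1 else 0)
          * ∏ j, (C j).patternProb δ (E j) := by
  have htot : ∑ E : (j : Fin K) → (C j).Gate → Bool, ∏ j, (C j).patternProb δ (E j) = 1 := by
    rw [sum_prod_pattern C fun j => (C j).patternProb δ]
    simp [sum_patternProb]
  have hδ : δ = ∑ E : (j : Fin K) → (C j).Gate → Bool, δ * ∏ j, (C j).patternProb δ (E j) := by
    rw [← Finset.mul_sum, htot, mul_one]
  conv_rhs => lhs; rw [hδ]
  rw [Finset.mul_sum, ← Finset.sum_add_distrib]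
  unfold errorProb
  simp only [join_value_out, join_patternProb]
  rw [← (joinPattern C i φ).symm.sum_comp, Fintype.sum_prod_type_right]
  refine Finset.sum_congr rfl fun E _ => ?_
  have hgate : ∀ (c : Bool) (p : ℝ), (∑ r : Bool,
      if xor r c ≠ b then (if r = true then δ else 1 - δ) * p else 0)
        = δ * p + (1 - 2 * δ) * ((if c ≠ b then 1 else 0) * p) := by
    intro c p
    cases c <;> cases b <;> simp <;> ring
  exact hgate (φ (x i) fun j => (C j).value x (E j) (C j).out) (∏ j, (C j).patternProb δ (E j))

end Tree

/-! ### Majority votes among independent copies -/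

/-- Whether strictly more than half of the bits `z j` for `j ∈ s` are `true`. A tie counts as
`false`. -/
def majority {K : ℕ} (s : Finset (Fin K)) (z : Fin K → Bool) : Bool :=
  decide (s.card < 2 * (s.filter fun j => z j = true).card)

/-- The Chernoff weight of a vote: a wrong majority has total weight at least one, if wrong votes
weigh `a` and right ones `a⁻¹`, where `a ≥ 1`. -/
theorem one_le_prod_of_majority_ne {K : ℕ} {s : Finset (Fin K)} {z : Fin K → Bool} {b : Bool}
    (h : majority s z ≠ b) {a : ℝ} (ha : 1 ≤ a) :
    1 ≤ ∏ j ∈ s, if z j ≠ b then a else a⁻¹ := by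
  rw [Finset.prod_ite, Finset.prod_const, Finset.prod_const, inv_pow, ← div_eq_mul_inv,
    one_le_div (by positivity)]
  refine pow_le_pow_right₀ ha ?_
  have hsum := Finset.card_filter_add_card_filter_not (s := s) fun j => z j = true
  cases b <;> simp [majority] at h hsum ⊢ <;> omega

/-- The output gate takes the majority vote of the `m` copies that are labelled by the value of the
input `x i`; the other copies are ignored. -/
theorem errorProb_join_majority_le {K m : ℕ} (L : Fin K → Bool) (D : Bool → BooleanCircuit n)
    (i : Fin n) {δ β : ℝ} (hδ : 0 ≤ δ) (hδ' : δ ≤ 1 / 2) (hβ : 0 ≤ β) (x : Fin n → Bool) (b : Bool)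
    (hL : (Finset.univ.filter fun j => L j = x i).card = m)
    (hD : (D (x i)).errorProb δ x b ≤ (1 - β) / 2) :
    (join (fun j => D (L j)) i fun c z =>
      majority (Finset.univ.filter fun j => L j = c) z).errorProb δ x b ≤ δ + (1 - 2 * δ) * (1 - β ^ 2 / 2) ^ m := by
  rw [errorProb_join]
  have hδ2 : 0 ≤ 1 - 2 * δ := by linarith
  gcongr
  set s := Finset.univ.filter fun j => L j = x i with hs
  -- With `a = 1 + β` the expected weight of a vote is at most
  -- `(1 - β) / 2 * a + (1 + β) / 2 * a⁻¹ = 1 - β² / 2`.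
  let w : (j : Fin K) → ((D (L j)).Gate → Bool) → ℝ := fun j e =>
    if L j = x i then (if (D (L j)).value x e (D (L j)).out ≠ b then 1 + β else (1 + β)⁻¹) else 1
  have hw : ∀ j e, 0 ≤ w j e := fun j e => by
    simp only [w]
    split_ifs <;> positivity
  have hP : ∀ j e, 0 ≤ (D (L j)).patternProb δ e := fun j e =>
    (D (L j)).patternProb_nonneg hδ hδ' e
  have hfac : ∀ j, ∑ e, w j e * (D (L j)).patternProb δ e
      ≤ if L j = x i then 1 - β ^ 2 / 2 else 1 := by
    intro j
    by_cases hj : L j = x i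
    swap
    · simp [w, hj, sum_patternProb]
    rw [← hj] at hD
    have hsplit : ∑ e, w j e * (D (L j)).patternProb δ e
        = (1 + β)⁻¹ + ((1 + β) - (1 + β)⁻¹) * (D (L j)).errorProb δ x b := by
      have h1 : (1 + β)⁻¹ = ∑ e, (1 + β)⁻¹ * (D (L j)).patternProb δ e := by
        rw [← Finset.mul_sum, sum_patternProb, mul_one]
      conv_rhs => lhs; rw [h1]
      unfold errorProb
      rw [Finset.mul_sum, ← Finset.sum_add_distrib]
      refine Finset.sum_congr rfl fun e _ => ?_
      simp only [w, hj, if_true]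
      split_ifs <;> ring
    rw [hsplit, if_pos hj]
    have hinv : (1 + β)⁻¹ ≤ 1 := inv_le_one_of_one_le₀ (by linarith)
    have hnn : 0 ≤ (1 + β) - (1 + β)⁻¹ := by linarith
    calc _ ≤ (1 + β)⁻¹ + ((1 + β) - (1 + β)⁻¹) * ((1 - β) / 2) := by gcongr
      _ = 1 - β ^ 2 / 2 := by
        field_simp
        ring
  calc _ ≤ ∑ E : (j : Fin K) → (D (L j)).Gate → Bool,
        ∏ j, w j (E j) * (D (L j)).patternProb δ (E j) := by
        refine Finset.sum_le_sum fun E _ => ?_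
        rw [Finset.prod_mul_distrib]
        refine mul_le_mul_of_nonneg_right ?_ (Finset.prod_nonneg fun j _ => hP j _)
        split_ifs with h
        · refine (one_le_prod_of_majority_ne h (by linarith : 1 ≤ 1 + β)).trans_eq ?_
          rw [hs, Finset.prod_filter]
        · exact Finset.prod_nonneg fun j _ => hw j _
    _ = ∏ j, ∑ e, w j e * (D (L j)).patternProb δ e :=
        sum_prod_pattern (fun j => D (L j)) fun j e => w j e * (D (L j)).patternProb δ e
    _ ≤ ∏ j, if L j = x i then 1 - β ^ 2 / 2 else 1 :=
        Finset.prod_le_prod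
          (fun j _ => Finset.sum_nonneg fun e _ => mul_nonneg (hw j e) (hP j e)) fun j _ => hfac j
    _ = (1 - β ^ 2 / 2) ^ m := by
        rw [← Finset.prod_filter, Finset.prod_const, hL]

end BooleanCircuit

/-- Half of the indices below `2m` carry either label. -/
theorem card_filter_lt_eq (m : ℕ) (c : Bool) :
    (Finset.univ.filter fun j : Fin (m + m) => decide (j.val < m) = c).card = m := by
  have h := Finset.card_filter_add_card_filter_not (s := (Finset.univ : Finset (Fin (m + m))))
    fun j => j.val < m
  have h1 : (Finset.univ.filter fun j : Fin (m + m) => j.val < m).card = m := by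
    rw [Fin.card_filter_val_lt]
    omega
  cases c <;> simp at h h1 ⊢ <;> omega

/-- A Boolean function is computed by branching on its variables one after the other. The bias
`β = (1 - 2δ) / 2` of a subcircuit's output is preserved: `m` copies of it have a wrong majority
with probability at most `exp (-m β² / 2) ≤ 1 / 4`, which the noise of the output gate turns into
bias at least `β`. -/
theorem reliableComputation_of_le {k m : ℕ} {δ : ℝ} (hδ : 0 ≤ δ) (hδ' : δ < 1 / 2)
    (hk : m + m + 1 ≤ k) (hm : 24 ≤ m * (1 - 2 * δ) ^ 2) : ReliableComputation k δ := by
  refine ⟨(1 - 2 * δ) / 4, by linarith, fun n f => ?_⟩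
  suffices H : ∀ j ≤ n, ∀ f : (Fin n → Bool) → Bool,
      (∀ x y, (∀ i, i.val < j → x i = y i) → f x = f y) →
      ∃ C : BooleanCircuit n, C.FanInLE k ∧ ∀ x, C.errorProb δ x (f x) ≤
        1 / 2 - (1 - 2 * δ) / 4 from
    H n le_rfl f fun x y h => congrArg f (funext fun i => h i i.2)
  intro j
  induction j with
  | zero =>
    intro _ f hf
    refine ⟨BooleanCircuit.constGate n (f fun _ => false), fun _ => ?_, fun x => ?_⟩
    · change 1 ≤ k
      omega
    · rw [hf x (fun _ => false) fun i hi => absurd hi (Nat.not_lt_zero _),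
        BooleanCircuit.errorProb_constGate]
      linarith
  | succ j ih =>
    intro hj f hf
    let i : Fin n := ⟨j, hj⟩
    have hstep : ∀ c, ∃ C : BooleanCircuit n, C.FanInLE k ∧
        ∀ x, C.errorProb δ x (f (Function.update x i c)) ≤ 1 / 2 - (1 - 2 * δ) / 4 := by
      intro c
      refine ih (by omega) (fun x => f (Function.update x i c)) fun x y hxy => hf _ _ fun l hl => ?_
      by_cases hli : l = i
      · simp [hli]
      · rw [Function.update_of_ne hli, Function.update_of_ne hli]
        refine hxy l (lt_of_le_of_ne (Nat.lt_succ_iff.mp hl) fun h => hli (Fin.ext h))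
    choose D hDk hD using hstep
    refine ⟨_, BooleanCircuit.join_fanInLE (fun l : Fin (m + m) => D (decide (l.val < m))) i
      (fun c z => BooleanCircuit.majority
        (Finset.univ.filter fun l : Fin (m + m) => decide (l.val < m) = c) z)
      (fun l => hDk _) hk, fun x => ?_⟩
    have hDx := hD (x i) x
    rw [Function.update_eq_self] at hDx
    have hle := BooleanCircuit.errorProb_join_majority_le (β := (1 - 2 * δ) / 2)
      (fun l : Fin (m + m) => decide (l.val < m)) D i hδ hδ'.le (by linarith) x (f x)
      (card_filter_lt_eq m (x i)) (by linarith)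
    refine hle.trans ?_
    have hquarter : (1 - ((1 - 2 * δ) / 2) ^ 2 / 2) ^ m ≤ 1 / 4 := by
      have hbase : 0 ≤ 1 - ((1 - 2 * δ) / 2) ^ 2 / 2 := by nlinarith
      calc (1 - ((1 - 2 * δ) / 2) ^ 2 / 2) ^ m
          ≤ Real.exp (-(((1 - 2 * δ) / 2) ^ 2 / 2)) ^ m :=
            pow_le_pow_left₀ hbase (Real.one_sub_le_exp_neg _) m
        _ = Real.exp (-(m * (1 - 2 * δ) ^ 2 / 8)) := by
            rw [← Real.exp_nat_mul]
            ring_nf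
        _ ≤ Real.exp (-3) := Real.exp_le_exp.mpr (by linarith)
        _ ≤ 1 / 4 := by
            rw [Real.exp_neg, ← one_div]
            exact one_div_le_one_div_of_le (by norm_num) (by linarith [Real.add_one_le_exp (3 : ℝ)])
    have := mul_le_mul_of_nonneg_left hquarter (by linarith : 0 ≤ 1 - 2 * δ)
    linarith

/-! ### The noise threshold -/

/-- By the Evans–Schulman bound, reliable computation forces `1 - 2δ > 1 / √k`. -/
theorem deltaStar_le_deltaES {k : ℕ} (hk : 1 ≤ k) : deltaStar k ≤ deltaES k := by
  have hk' : (1 : ℝ) ≤ k := by exact_mod_cast hk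
  have hs : 1 ≤ Real.sqrt k := Real.one_le_sqrt.mpr hk'
  refine Real.sSup_le ?_ ?_
  · rintro δ ⟨h0, h1, hR⟩
    by_contra! hlt
    refine not_reliableComputation h0 h1 ?_ hR
    unfold deltaES at hlt
    have h2 : 1 - 2 * δ ≤ 1 / Real.sqrt k := by
      have : 1 / Real.sqrt k = 2 * (1 / (2 * Real.sqrt k)) := by field_simp
      linarith
    rw [le_div_iff₀ (by linarith)] at h2
    have h3 : 0 ≤ (1 - 2 * δ) * Real.sqrt k := mul_nonneg (by linarith) (by linarith)
    calc (1 - 2 * δ) ^ 2 * k = ((1 - 2 * δ) * Real.sqrt k) ^ 2 := by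
          rw [mul_pow, Real.sq_sqrt (by linarith)]
      _ ≤ 1 := pow_le_one₀ h3 h2
  -- The bound has to be nonnegative too, as the supremum of the empty set is zero.
  · unfold deltaES
    rw [sub_nonneg]
    exact one_div_le_one_div_of_le (by norm_num) (by linarith)

/-- With `m = ⌊(k - 1) / 2⌋`, noise that leaves `1 - 2δ ≥ 10 / √k` gives `m (1 - 2δ)²` at least
`50 - 100 / k`, which exceeds the required `24` for `k ≥ 4`. -/
theorem reliableComputation_of_le_half_sub {k : ℕ} (hk : 4 ≤ k) {δ : ℝ} (hδ : 0 ≤ δ)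
    (hδ' : δ ≤ 1 / 2 - 5 / Real.sqrt k) : ReliableComputation k δ := by
  have hk' : (4 : ℝ) ≤ k := by exact_mod_cast hk
  have hs : 0 < Real.sqrt k := Real.sqrt_pos.mpr (by linarith)
  have h5 : 0 < 5 / Real.sqrt k := by positivity
  have hm : (k : ℝ) - 2 ≤ 2 * ((k - 1) / 2 : ℕ) := by
    have : k ≤ 2 * ((k - 1) / 2) + 2 := by omega
    have : (k : ℝ) ≤ 2 * ((k - 1) / 2 : ℕ) + 2 := by exact_mod_cast this
    linarith
  refine reliableComputation_of_le (m := (k - 1) / 2) hδ (by linarith) (by omega) ?_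
  have hsq : 100 / (k : ℝ) ≤ (1 - 2 * δ) ^ 2 := by
    have : 100 / (k : ℝ) = (10 / Real.sqrt k) ^ 2 := by
      rw [div_pow, Real.sq_sqrt (by linarith)]
      norm_num
    rw [this]
    refine pow_le_pow_left₀ (by positivity) ?_ 2
    have : 10 / Real.sqrt k = 2 * (5 / Real.sqrt k) := by ring
    linarith
  calc (24 : ℝ) ≤ ((k : ℝ) - 2) / 2 * (100 / k) := by
        rw [div_mul_div_comm, le_div_iff₀ (by linarith)]
        linarith
    _ ≤ ((k - 1) / 2 : ℕ) * (1 - 2 * δ) ^ 2 := by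
        gcongr
        linarith

theorem half_sub_le_deltaStar {k : ℕ} (hk : 100 ≤ k) : 1 / 2 - 5 / Real.sqrt k ≤ deltaStar k := by
  have hk' : (100 : ℝ) ≤ k := by exact_mod_cast hk
  have hs : 10 ≤ Real.sqrt k := Real.le_sqrt_of_sq_le (by linarith)
  have h5 : 5 / Real.sqrt k ≤ 1 / 2 := by
    rw [div_le_div_iff₀ (by linarith) (by norm_num)]
    linarith
  refine le_csSup ⟨1 / 2, fun δ hδ => hδ.2.1⟩ ⟨by linarith, ?_, ?_⟩
  · have : 0 ≤ 5 / Real.sqrt k := by positivity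
    linarith
  · exact reliableComputation_of_le_half_sub (by omega) (by linarith) le_rfl

theorem lemma2p6 :
    Tendsto deltaStar atTop (𝓝 (1 / 2)) ∧
    (fun k : ℕ => 1 / 2 - deltaStar k) =Θ[atTop] (fun k : ℕ => 1 / 2 - deltaES k) ∧
    (fun k : ℕ => 1 / 2 - deltaStar k) =Θ[atTop] (fun k : ℕ => 1 / Real.sqrt k) ∧
    (∃ c : ℝ, 0 < c ∧ ∀ᶠ k : ℕ in atTop, ∀ δ : ℝ,
      0 ≤ δ → δ ≤ 1 / 2 - c / Real.sqrt k → ReliableComputation k δ) := by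
  have hES : (fun k : ℕ => 1 / 2 - deltaES k) = fun k : ℕ => 1 / 2 * (1 / Real.sqrt k) := by
    funext k
    unfold deltaES
    rw [sub_sub_cancel, one_div_mul_one_div]
  have hlow : ∀ k : ℕ, 1 ≤ k → 1 / 2 * (1 / Real.sqrt k) ≤ 1 / 2 - deltaStar k := fun k hk => by
    have := deltaStar_le_deltaES hk
    have := congrFun hES k
    linarith
  have hup : ∀ k : ℕ, 100 ≤ k → 1 / 2 - deltaStar k ≤ 5 * (1 / Real.sqrt k) := fun k hk => by
    have := half_sub_le_deltaStar hk
    rw [mul_one_div]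
    linarith
  have hroot : ∀ k : ℕ, 0 ≤ 1 / Real.sqrt k := fun k => by positivity
  have hlim : Tendsto (fun k : ℕ => 1 / Real.sqrt k) atTop (𝓝 0) := by
    simp only [one_div]
    exact tendsto_inv_atTop_zero.comp (Real.tendsto_sqrt_atTop.comp tendsto_natCast_atTop_atTop)
  have hTheta : (fun k : ℕ => 1 / 2 - deltaStar k) =Θ[atTop] fun k : ℕ => 1 / Real.sqrt k := by
    refine ⟨IsBigO.of_bound 5 ?_, IsBigO.of_bound 2 ?_⟩
    · filter_upwards [eventually_ge_atTop 100] with k hk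
      have h1 := hlow k (by omega)
      have h2 := hroot k
      rw [Real.norm_of_nonneg (by linarith), Real.norm_of_nonneg h2]
      exact hup k hk
    · filter_upwards [eventually_ge_atTop 1] with k hk
      have h1 := hlow k hk
      have h2 := hroot k
      rw [Real.norm_of_nonneg (by linarith : 0 ≤ 1 / 2 - deltaStar k), Real.norm_of_nonneg h2]
      linarith
  refine ⟨?_, ?_, hTheta, 5, by norm_num, ?_⟩
  · have h := hTheta.1.trans_tendsto hlim
    have h' := (h.const_sub (1 / 2)).congr fun k => sub_sub_cancel (1 / 2) (deltaStar k)
    rwa [sub_zero] at h'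
  · rw [hES]
    exact hTheta.trans (isTheta_rfl.const_mul_right (by norm_num))
  · filter_upwards [eventually_ge_atTop 4] with k hk δ h0 h1
    exact reliableComputation_of_le_half_sub hk h0 h1
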